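/- **Theorem (Representation of boolean functions by the Thompson group).** The Thompson group $G_{2,1}$ consists of all maximally extended isomorphisms $\varphi : R_1 \to R_2$ between finitely generated essential right ideals of $\{0,1\}^*$ (bijections with $\varphi(rz) = \varphi(r)z$ for $r\in R_1$, $z\in\{0,1\}^*$); the product is composition, acting on the left, followed by maximal extension. For $1 \le i < j$, $\tau_{i,j}$ is the position transposition that exchanges the $i$th and the $j$th bit of every bitstring of length at least $j$; it determines an element of $G_{2,1}$. A circuit with $m$ input ports and $n$ output ports is made from the gates and, or, not, fork (applied to a wire, or to two neighbouring wires) and from wire-swappings $\tau_{i,j}$, with no wire left unconnected. Its size $|C|$ is the number of gates (forks and wire-swappings included) plus the number $m+n$ of input and output ports. Let $\Gamma_{G_{2,1}}$ be a finite generating set of $G_{2,1}$. There is a constant $c$, depending only on $\Gamma_{G_{2,1}}$, such that the following holds for all $m, n$, every total function $f : \{0,1\}^m \to \{0,1\}^n$, and every minimum-size circuit $C_f$ that computes $f$. There is a word $W_f$ over the alphabet consisting of the elements of $\Gamma_{G_{2,1}}$, their formal inverses, and the symbols $\tau_{i,i+1}$ ($i \ge 1$), representing an element $w_f \in G_{2,1}$,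 such that: - for all $x \in \{0,1\}^m$, $w_f$ is defined at $0\,x$ and $w_f(0\,x) = 0\, f(x)\, x$; - $|W_f| \le c\,|C_f|^4$; - every symbol $\tau_{i,i+1}$ that occurs in $W_f$ satisfies $i + 1 \le |C_f|^2 + 2$. -/

import Mathlib

/-! ## Words, right ideals and the Thompson group `G_{2,1}` -/

namespace Thompson

/-- Bitstrings, i.e. elements of `{0,1}^*`, with `0 = false` and `1 = true`. -/
abbrev Word : Type := List Bool

/-- `R` is a right ideal of `{0,1}^*`. -/
def IsRightIdeal (R : Set Word) : Prop :=
  ∀ u ∈ R, ∀ z : Word, u ++ z ∈ R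

/-- `R = C {0,1}^*` for some finite set `C`. -/
def IsFinGen (R : Set Word) : Prop :=
  ∃ C : Set Word, C.Finite ∧ R = {w | ∃ c ∈ C, ∃ z : Word, w = c ++ z}

/-- `R` meets every (non-empty) right ideal. -/
def IsEssential (R : Set Word) : Prop :=
  ∀ S : Set Word, S.Nonempty → IsRightIdeal S → (R ∩ S).Nonempty

/-- The domain of a partial injective map on words. -/
def dom (φ : Word ≃. Word) : Set Word := {u | ∃ v, v ∈ φ u}

/-- `φ` is an isomorphism between two finitely generated essential right ideals of `{0,1}^*`,
namely from `dom φ` onto its image `dom φ.symm`. -/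
structure IsRightIdealIso (φ : Word ≃. Word) : Prop where
  map_append : ∀ u v : Word, v ∈ φ u → ∀ z : Word, v ++ z ∈ φ (u ++ z)
  dom_finGen : IsFinGen (dom φ)
  dom_essential : IsEssential (dom φ)
  im_finGen : IsFinGen (dom φ.symm)
  im_essential : IsEssential (dom φ.symm)

/-- `φ` has no proper extension to an isomorphism between finitely generated essential
right ideals (`φ ≤ ψ` means that `ψ` extends `φ`). -/
def IsMaximal (φ : Word ≃. Word) : Prop :=
  ∀ ψ : Word ≃. Word, IsRightIdealIso ψ → φ ≤ ψ → ψ = φ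

/-! ### Right ideals: finitely generated and essential means cofinite -/

theorem le_iff {φ ψ : Word ≃. Word} : φ ≤ ψ ↔ ∀ u v, v ∈ φ u → v ∈ ψ u :=
  ⟨fun h u v => h u v, fun h u v => h u v⟩

theorem exists_length {R : Set Word} (hf : IsFinGen R) (he : IsEssential R) :
    ∃ N : ℕ, ∀ w : Word, N ≤ w.length → w ∈ R := by
  obtain ⟨C, hC, rfl⟩ := hf
  obtain ⟨N, hN⟩ := (hC.image List.length).bddAbove
  refine ⟨N, fun w hw => ?_⟩
  obtain ⟨x, ⟨c, hc, z, rfl⟩, ⟨t, ht⟩⟩ := he {x | ∃ t : Word, x = w ++ t} ⟨w, [], by simp⟩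
    (by rintro u ⟨t, rfl⟩ z; exact ⟨t ++ z, by simp⟩)
  have hcl : c.length ≤ w.length := (hN ⟨c, hc, rfl⟩).trans hw
  have hp : c <+: w := List.prefix_of_prefix_length_le ⟨z, rfl⟩ ⟨t, ht.symm⟩ hcl
  obtain ⟨s, rfl⟩ := hp
  exact ⟨c, hc, s, rfl⟩

theorem isFinGen_of_length {R : Set Word} (hR : IsRightIdeal R) {N : ℕ}
    (hN : ∀ w : Word, N ≤ w.length → w ∈ R) : IsFinGen R := by
  refine ⟨{w | w ∈ R ∧ w.length ≤ N}, ?_, ?_⟩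
  · exact (List.finite_length_le Bool N).subset fun w hw => hw.2
  · ext w
    constructor
    · intro hw
      by_cases h : w.length ≤ N
      · exact ⟨w, ⟨hw, h⟩, [], by simp⟩
      · exact ⟨w.take N, ⟨hN _ (by simp; omega), by simp⟩, w.drop N, by simp⟩
    · rintro ⟨c, ⟨hc, -⟩, z, rfl⟩
      exact hR c hc z

theorem isEssential_of_length {R : Set Word} {N : ℕ}
    (hN : ∀ w : Word, N ≤ w.length → w ∈ R) : IsEssential R := by
  rintro S ⟨s, hs⟩ hS
  exact ⟨s ++ List.replicate N false, hN _ (by simp), hS s hs _⟩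

theorem isRightIdealIso_of {φ : Word ≃. Word}
    (hφ : ∀ u v : Word, v ∈ φ u → ∀ z : Word, v ++ z ∈ φ (u ++ z))
    {N M : ℕ} (hN : ∀ w : Word, N ≤ w.length → w ∈ dom φ)
    (hM : ∀ w : Word, M ≤ w.length → w ∈ dom φ.symm) : IsRightIdealIso φ where
  map_append := hφ
  dom_finGen := isFinGen_of_length (fun u ⟨v, hv⟩ z => ⟨v ++ z, hφ u v hv z⟩) hN
  dom_essential := isEssential_of_length hN
  im_finGen := isFinGen_of_length
    (fun u ⟨v, hv⟩ z => ⟨v ++ z, by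
      rw [PEquiv.mem_iff_mem] at hv ⊢; exact hφ v u hv z⟩) hM
  im_essential := isEssential_of_length hM

theorem IsRightIdealIso.symm {φ : Word ≃. Word} (h : IsRightIdealIso φ) :
    IsRightIdealIso φ.symm where
  map_append u v hv z := by
    rw [PEquiv.mem_iff_mem] at hv ⊢; exact h.map_append v u hv z
  dom_finGen := h.im_finGen
  dom_essential := h.im_essential
  im_finGen := h.dom_finGen
  im_essential := h.dom_essential

theorem isRightIdealIso_refl : IsRightIdealIso (PEquiv.refl Word) :=
  isRightIdealIso_of (N := 0) (M := 0) (by simp) (fun w _ => ⟨w, by simp⟩)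
    (fun w _ => ⟨w, by simp⟩)

theorem dom_trans {φ ψ : Word ≃. Word} (hφ : IsRightIdealIso φ) (hψ : IsRightIdealIso ψ) :
    ∃ N : ℕ, ∀ w : Word, N ≤ w.length → w ∈ dom (φ.trans ψ) := by
  obtain ⟨N, hN⟩ := exists_length hφ.dom_finGen hφ.dom_essential
  obtain ⟨M, hM⟩ := exists_length hψ.dom_finGen hψ.dom_essential
  refine ⟨N + M, fun w hw => ?_⟩
  obtain ⟨v, hv⟩ := hN (w.take N) (by simp; omega)
  have h1 := hφ.map_append _ _ hv (w.drop N)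
  rw [List.take_append_drop] at h1
  obtain ⟨t, ht⟩ := hM (v ++ w.drop N) (by simp; omega)
  exact ⟨t, (PEquiv.mem_trans _ _ _ _).2 ⟨_, h1, ht⟩⟩

theorem IsRightIdealIso.trans {φ ψ : Word ≃. Word} (hφ : IsRightIdealIso φ)
    (hψ : IsRightIdealIso ψ) : IsRightIdealIso (φ.trans ψ) := by
  obtain ⟨N, hN⟩ := dom_trans hφ hψ
  obtain ⟨M, hM⟩ := dom_trans hψ.symm hφ.symm
  refine isRightIdealIso_of (N := N) (M := M) ?_ hN hM
  intro u v hv z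
  rw [PEquiv.mem_trans] at hv ⊢
  obtain ⟨t, h1, h2⟩ := hv
  exact ⟨t ++ z, hφ.map_append _ _ h1 z, hψ.map_append _ _ h2 z⟩

/-! ### The unique maximal extension -/

/-- `u ↦ v` under some extension of `φ`. -/
def ExtRel (φ : Word ≃. Word) (u v : Word) : Prop :=
  ∃ ψ : Word ≃. Word, IsRightIdealIso ψ ∧ φ ≤ ψ ∧ v ∈ ψ u

theorem symm_le_symm {φ ψ : Word ≃. Word} (h : φ ≤ ψ) : φ.symm ≤ ψ.symm := by
  rw [le_iff] at h ⊢
  intro u v hv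
  rw [PEquiv.mem_iff_mem] at hv ⊢
  exact h _ _ hv

theorem ExtRel.symm {φ : Word ≃. Word} {u v : Word} (h : ExtRel φ u v) :
    ExtRel φ.symm v u := by
  obtain ⟨ψ, h1, h2, h3⟩ := h
  exact ⟨ψ.symm, h1.symm, symm_le_symm h2, by rwa [PEquiv.mem_iff_mem]⟩

theorem ExtRel.unique {φ : Word ≃. Word} (hφ : IsRightIdealIso φ) {u v v' : Word}
    (h : ExtRel φ u v) (h' : ExtRel φ u v') : v = v' := by
  obtain ⟨ψ, h1, h2, h3⟩ := h
  obtain ⟨ψ', h1', h2', h3'⟩ := h'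
  obtain ⟨N, hN⟩ := exists_length hφ.dom_finGen hφ.dom_essential
  obtain ⟨t, ht⟩ := hN (u ++ List.replicate N false) (by simp)
  have e := Option.mem_unique (le_iff.1 h2 _ _ ht) (h1.map_append _ _ h3 _)
  have e' := Option.mem_unique (le_iff.1 h2' _ _ ht) (h1'.map_append _ _ h3' _)
  exact List.append_cancel_right (e.symm.trans e')

open Classical in
/-- The maximal extension `max(φ)`: the union of all extensions of `φ` to isomorphisms between
finitely generated essential right ideals. -/
noncomputable def maxExt (φ : Word ≃. Word) (hφ : IsRightIdealIso φ) : Word ≃. Word where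
  toFun u := if h : ∃ v, ExtRel φ u v then some h.choose else none
  invFun v := if h : ∃ u, ExtRel φ u v then some h.choose else none
  inv u v := by
    have key : ∀ u v : Word, (v ∈ (if h : ∃ v, ExtRel φ u v then some h.choose else none :
        Option Word)) ↔ ExtRel φ u v := by
      intro u v
      split_ifs with h
      · rw [Option.mem_some_iff]
        exact ⟨fun e => e ▸ h.choose_spec, fun h' => h.choose_spec.unique hφ h'⟩
      · simp only [Option.not_mem_none, false_iff]
        exact fun h' => h ⟨v, h'⟩
    have key' : ∀ u v : Word, (u ∈ (if h : ∃ u, ExtRel φ u v then some h.choose else none :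
        Option Word)) ↔ ExtRel φ u v := by
      intro u v
      split_ifs with h
      · rw [Option.mem_some_iff]
        exact ⟨fun e => e ▸ h.choose_spec,
          fun h' => h.choose_spec.symm.unique hφ.symm h'.symm⟩
      · simp only [Option.not_mem_none, false_iff]
        exact fun h' => h ⟨u, h'⟩
    exact (key' u v).trans (key u v).symm

theorem mem_maxExt {φ : Word ≃. Word} (hφ : IsRightIdealIso φ) {u v : Word} :
    v ∈ maxExt φ hφ u ↔ ExtRel φ u v := by
  classical
  change v ∈ (if h : ∃ v, ExtRel φ u v then some h.choose else none : Option Word) ↔ _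
  split_ifs with h
  · rw [Option.mem_some_iff]
    exact ⟨fun e => e ▸ h.choose_spec, fun h' => h.choose_spec.unique hφ h'⟩
  · simp only [Option.not_mem_none, false_iff]
    exact fun h' => h ⟨v, h'⟩

theorem le_maxExt {φ : Word ≃. Word} (hφ : IsRightIdealIso φ) : φ ≤ maxExt φ hφ :=
  le_iff.2 fun _ _ hv => (mem_maxExt hφ).2 ⟨φ, hφ, le_refl φ, hv⟩

theorem ext_le_maxExt {φ ψ : Word ≃. Word} (hφ : IsRightIdealIso φ) (hψ : IsRightIdealIso ψ)
    (h : φ ≤ ψ) : ψ ≤ maxExt φ hφ :=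
  le_iff.2 fun _ _ hv => (mem_maxExt hφ).2 ⟨ψ, hψ, h, hv⟩

theorem isRightIdealIso_maxExt {φ : Word ≃. Word} (hφ : IsRightIdealIso φ) :
    IsRightIdealIso (maxExt φ hφ) := by
  obtain ⟨N, hN⟩ := exists_length hφ.dom_finGen hφ.dom_essential
  obtain ⟨M, hM⟩ := exists_length hφ.im_finGen hφ.im_essential
  refine isRightIdealIso_of (N := N) (M := M) ?_ ?_ ?_
  · intro u v hv z
    rw [mem_maxExt] at hv ⊢
    obtain ⟨ψ, h1, h2, h3⟩ := hv
    exact ⟨ψ, h1, h2, h1.map_append _ _ h3 z⟩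
  · intro w hw
    obtain ⟨v, hv⟩ := hN w hw
    exact ⟨v, le_iff.1 (le_maxExt hφ) _ _ hv⟩
  · intro w hw
    obtain ⟨v, hv⟩ := hM w hw
    exact ⟨v, le_iff.1 (symm_le_symm (le_maxExt hφ)) _ _ hv⟩

theorem isMaximal_maxExt {φ : Word ≃. Word} (hφ : IsRightIdealIso φ) :
    IsMaximal (maxExt φ hφ) := fun _ hψ h =>
  le_antisymm (ext_le_maxExt hφ hψ ((le_maxExt hφ).trans h)) h

/-- Any maximal isomorphism that extends `φ` is `max(φ)`. -/
theorem eq_maxExt {φ ψ : Word ≃. Word} (hφ : IsRightIdealIso φ) (hψ : IsRightIdealIso ψ)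
    (hm : IsMaximal ψ) (h : φ ≤ ψ) : ψ = maxExt φ hφ :=
  (hm _ (isRightIdealIso_maxExt hφ) (ext_le_maxExt hφ hψ h)).symm

theorem IsMaximal.symm {φ : Word ≃. Word} (h : IsMaximal φ) : IsMaximal φ.symm := by
  intro ψ hψ hle
  have := h ψ.symm hψ.symm (by simpa using symm_le_symm hle)
  rw [← this, PEquiv.symm_symm]

theorem trans_le_trans {φ φ' ψ ψ' : Word ≃. Word} (h : φ ≤ φ') (h' : ψ ≤ ψ') :
    φ.trans ψ ≤ φ'.trans ψ' := by
  rw [le_iff] at h h' ⊢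
  intro u v hv
  rw [PEquiv.mem_trans] at hv ⊢
  obtain ⟨t, h1, h2⟩ := hv
  exact ⟨t, h _ _ h1, h' _ _ h2⟩

/-! ### The group -/

/-- The Thompson group `G_{2,1}`: all maximally extended isomorphisms between finitely generated
essential right ideals of `{0,1}^*`. -/
def ThompsonGroup : Type :=
  {φ : Word ≃. Word // IsRightIdealIso φ ∧ IsMaximal φ}

/-- The element of `G_{2,1}` determined by an isomorphism of right ideals. -/
noncomputable def ThompsonGroup.ofIso (φ : Word ≃. Word) (hφ : IsRightIdealIso φ) :
    ThompsonGroup :=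
  ⟨maxExt φ hφ, isRightIdealIso_maxExt hφ, isMaximal_maxExt hφ⟩

theorem ThompsonGroup.eq_ofIso (g : ThompsonGroup) (φ : Word ≃. Word) (hφ : IsRightIdealIso φ)
    (h : φ ≤ g.1) : g = ThompsonGroup.ofIso φ hφ :=
  Subtype.ext (eq_maxExt hφ g.2.1 g.2.2 h)

theorem isMaximal_refl : IsMaximal (PEquiv.refl Word) := by
  intro ψ _ hle
  refine le_antisymm (le_iff.2 fun u v hv => ?_) hle
  have h2 : u ∈ ψ u := le_iff.1 hle u u (by simp)
  rw [Option.mem_unique hv h2]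
  simp

/-- Multiplication is composition (acting on the left) followed by maximal extension. -/
noncomputable instance : Mul ThompsonGroup where
  mul g h := ThompsonGroup.ofIso (h.1.trans g.1) (h.2.1.trans g.2.1)

instance : One ThompsonGroup where
  one := ⟨PEquiv.refl Word, isRightIdealIso_refl, isMaximal_refl⟩

instance : Inv ThompsonGroup where
  inv g := ⟨g.1.symm, g.2.1.symm, g.2.2.symm⟩

theorem ThompsonGroup.trans_le_mul (g h : ThompsonGroup) : h.1.trans g.1 ≤ (g * h).1 :=
  le_maxExt (h.2.1.trans g.2.1)

noncomputable instance : Group ThompsonGroup where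
  mul_assoc a b c := by
    have hiso : IsRightIdealIso ((c.1.trans b.1).trans a.1) :=
      (c.2.1.trans b.2.1).trans a.2.1
    rw [ThompsonGroup.eq_ofIso (a * b * c) _ hiso, ThompsonGroup.eq_ofIso (a * (b * c)) _ hiso]
    · exact (trans_le_trans (ThompsonGroup.trans_le_mul b c) le_rfl).trans
        (ThompsonGroup.trans_le_mul a (b * c))
    · rw [PEquiv.trans_assoc]
      exact (trans_le_trans le_rfl (ThompsonGroup.trans_le_mul a b)).trans
        (ThompsonGroup.trans_le_mul (a * b) c)
  one_mul a := (ThompsonGroup.eq_ofIso a _ _ (by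
    change a.1.trans (PEquiv.refl Word) ≤ a.1
    rw [PEquiv.trans_refl])).symm
  mul_one a := (ThompsonGroup.eq_ofIso a _ _ (by
    change (PEquiv.refl Word).trans a.1 ≤ a.1
    rw [PEquiv.refl_trans])).symm
  inv_mul_cancel a := (ThompsonGroup.eq_ofIso 1 _ _ (by
    change a.1.trans a.1.symm ≤ PEquiv.refl Word
    rw [le_iff]
    intro u v hv
    rw [PEquiv.mem_trans] at hv
    obtain ⟨t, h1, h2⟩ := hv
    rw [PEquiv.mem_iff_mem] at h2
    rw [PEquiv.inj _ h1 h2]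
    simp)).symm

/-! ## Bit transpositions -/

/-- The word `w` with the bits at positions `i` and `j` exchanged (positions start at 1). -/
def swapBits (i j : ℕ) (w : Word) : Word :=
  List.ofFn fun k : Fin w.length => w.getD (Equiv.swap i j (k + 1) - 1) false

/-- The bit position transposition `τ_{i,j}`, for `1 ≤ i < j`, as a partial map on `{0,1}^*`;
it is defined on the words of length at least `j`. -/
def bitTransposition (i j : ℕ) (w : Word) : Option Word :=
  if 1 ≤ i ∧ i < j ∧ j ≤ w.length then some (swapBits i j w) else none

theorem length_swapBits (i j : ℕ) (w : Word) : (swapBits i j w).length = w.length := by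
  simp [swapBits]

theorem swap_mem_range {i j l k : ℕ} (h : 1 ≤ i ∧ i < j ∧ j ≤ l) (hk : k < l) :
    1 ≤ Equiv.swap i j (k + 1) ∧ Equiv.swap i j (k + 1) ≤ l := by
  rw [Equiv.swap_apply_def]
  split_ifs <;> omega

theorem getD_swapBits {i j : ℕ} {w : Word} {k : ℕ} (hk : k < w.length) :
    (swapBits i j w).getD k false = w.getD (Equiv.swap i j (k + 1) - 1) false := by
  rw [List.getD_eq_getElem _ _ (by rwa [length_swapBits])]
  simp [swapBits]

theorem swapBits_swapBits {i j : ℕ} {w : Word} (h : 1 ≤ i ∧ i < j ∧ j ≤ w.length) :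
    swapBits i j (swapBits i j w) = w := by
  apply List.ext_getElem
  · simp [length_swapBits]
  · intro k h1 h2
    obtain ⟨h3, h4⟩ := swap_mem_range h h2
    rw [← List.getD_eq_getElem _ false h1, ← List.getD_eq_getElem _ false h2,
      getD_swapBits (by rwa [length_swapBits]), getD_swapBits (by omega),
      Nat.sub_add_cancel h3, Equiv.swap_apply_self, Nat.add_sub_cancel]

theorem swapBits_append {i j : ℕ} {w : Word} (h : 1 ≤ i ∧ i < j ∧ j ≤ w.length) (z : Word) :
    swapBits i j (w ++ z) = swapBits i j w ++ z := by
  apply List.ext_getElem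
  · simp [length_swapBits]
  · intro k h1 h2
    have h5 : k < (w ++ z).length := by rwa [length_swapBits] at h1
    rw [← List.getD_eq_getElem _ false h1, ← List.getD_eq_getElem _ false h2, getD_swapBits h5]
    by_cases hk : k < w.length
    · obtain ⟨h3, h4⟩ := swap_mem_range h hk
      rw [List.getD_append _ _ _ _ (by omega),
        List.getD_append _ _ _ _ (by rwa [length_swapBits]), getD_swapBits hk]
    · rw [Equiv.swap_apply_of_ne_of_ne (by omega) (by omega), Nat.add_sub_cancel,
        List.getD_append_right _ _ _ _ (by omega),
        List.getD_append_right _ _ _ _ (by rw [length_swapBits]; omega), length_swapBits]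

/-- `τ_{i,j}` as a partial injective map (it is its own inverse). -/
def bitTranspositionPEquiv (i j : ℕ) : Word ≃. Word where
  toFun := bitTransposition i j
  invFun := bitTransposition i j
  inv := by
    have key : ∀ u v : Word, u ∈ bitTransposition i j v → v ∈ bitTransposition i j u := by
      intro u v h
      unfold bitTransposition at h
      split_ifs at h with hc
      · rw [Option.mem_some_iff] at h
        subst h
        rw [bitTransposition, length_swapBits, if_pos hc, swapBits_swapBits hc]
        rfl
      · simp at h
    exact fun u v => ⟨key u v, key v u⟩

theorem isRightIdealIso_bitTransposition {i j : ℕ} (hi : 1 ≤ i) (hij : i < j) :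
    IsRightIdealIso (bitTranspositionPEquiv i j) := by
  have hd : ∀ w : Word, j ≤ w.length → ∃ v, v ∈ bitTransposition i j w := fun w hw =>
    ⟨swapBits i j w, by rw [bitTransposition, if_pos ⟨hi, hij, hw⟩]; rfl⟩
  refine isRightIdealIso_of (N := j) (M := j) ?_ hd hd
  intro u v hv z
  change v ∈ bitTransposition i j u at hv
  change v ++ z ∈ bitTransposition i j (u ++ z)
  unfold bitTransposition at hv
  split_ifs at hv with hc
  · rw [Option.mem_some_iff] at hv
    subst hv
    rw [bitTransposition, if_pos ⟨hc.1, hc.2.1, by simp; omega⟩, swapBits_append hc]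
    rfl
  · simp at hv

/-- The position transposition `τ_{i,j} ∈ G_{2,1}`, for `1 ≤ i < j`. -/
noncomputable def tau (i j : ℕ) (hi : 1 ≤ i) (hij : i < j) : ThompsonGroup :=
  ThompsonGroup.ofIso (bitTranspositionPEquiv i j) (isRightIdealIso_bitTransposition hi hij)

/-! ## Words over a generating set `Γ ∪ {τ_{i,i+1} : 1 ≤ i}` -/

/-- Letters: the elements of `Γ`, their formal inverses, and the symbols `τ_{i,i+1}`, `1 ≤ i`. -/
inductive Letter (Γ : Set ThompsonGroup) : Type
  | gen (g : Γ) : Letter Γ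
  | genInv (g : Γ) : Letter Γ
  | trans (i : ℕ) (hi : 1 ≤ i) : Letter Γ

/-- The element of `G_{2,1}` denoted by a letter. -/
noncomputable def Letter.eval {Γ : Set ThompsonGroup} : Letter Γ → ThompsonGroup
  | .gen g => g
  | .genInv g => (g : ThompsonGroup)⁻¹
  | .trans i hi => tau i (i + 1) hi (Nat.lt_succ_self i)

/-- The element of `G_{2,1}` represented by a word. -/
noncomputable def evalWord {Γ : Set ThompsonGroup} (W : List (Letter Γ)) : ThompsonGroup :=
  (W.map Letter.eval).prod

/-! ## Combinational circuits -/

/-- The gates, apart from wire-swappings. -/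
inductive Gate : Type
  | and | or | not | fork

/-- The action of a gate on the topmost wires of a column of wires. -/
def Gate.apply : Gate → Word → Option Word
  | .and, x :: y :: w => some ((x && y) :: w)
  | .or, x :: y :: w => some ((x || y) :: w)
  | .not, x :: w => some ((!x) :: w)
  | .fork, x :: w => some (x :: x :: w)
  | _, _ => none

/-- Apply a map below the first `k` wires, which are left unchanged. -/
def belowWires (F : Word → Option Word) : ℕ → Word → Option Word
  | 0, w => F w
  | _ + 1, [] => none
  | k + 1, x :: w => (belowWires F k w).map (x :: ·)

/-- An elementary slice of a circuit: a gate placed below the first `k` wires (so its input wires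
are wire number `k + 1`, and `k + 2` for a binary gate), or a wire-swapping `τ_{i,j}`;
all the other wires pass through. -/
inductive Slice : Type
  | gate (g : Gate) (k : ℕ) : Slice
  | swap (i j : ℕ) : Slice

/-- The effect of a slice on the values of the wires; `none` if the wires that it needs
do not exist. -/
def Slice.apply : Slice → Word → Option Word
  | .gate g k, w => belowWires g.apply k w
  | .swap i j, w => bitTransposition i j w

/-- A circuit with `m` input ports and `n` output ports, cut from left to right into slices
each of which holds exactly one gate or one wire-swapping. -/
structure Circuit (m n : ℕ) : Type where
  slices : List Slice

/-- The size: the number of gates (including forks and wire-swappings) and of input and output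
ports. -/
def Circuit.size {m n : ℕ} (C : Circuit m n) : ℕ := m + n + C.slices.length

/-- The values on the output wires, given the values on the input wires. -/
def Circuit.run {m n : ℕ} (C : Circuit m n) (x : Word) : Option Word :=
  C.slices.foldlM (fun w s => s.apply w) x

/-- `C` has the input-output function `f : {0,1}^m → {0,1}^n`. -/
def Circuit.Computes {m n : ℕ} (C : Circuit m n) (f : (Fin m → Bool) → (Fin n → Bool)) : Prop :=
  ∀ x : Fin m → Bool, C.run (List.ofFn x) = some (List.ofFn (f x))

/-- `C` is a circuit of minimum size among those that compute `f`. -/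
def Circuit.IsMinimumFor {m n : ℕ} (C : Circuit m n) (f : (Fin m → Bool) → (Fin n → Bool)) :
    Prop :=
  C.Computes f ∧ ∀ C' : Circuit m n, C'.Computes f → C.size ≤ C'.size

end Thompson

/-!
The proof is a reversible simulation of a circuit. The state of the computation is a word
`0 y h`, where `y` holds the values on the current wires and `h` holds garbage. For every gate
`g`, the map `0 u ↦ 0 g(u) u` on the input bits `u` of `g` (for a fork, just `0 u ↦ 0 g(u)`) is a
replacement of prefixes taken from a prefix code. The words that begin with `1` leave enough room to
extend it to an element of `G_{2,1}` (`Gate.exists_element`). Over a generating set these four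
elements cost at most a constant number `K` of letters (`exists_gate_bound`).

To apply a gate at a given depth, its input bits are moved to the front by adjacent transpositions,
the gate is applied, its output is moved back, and its garbage is moved behind all the wires
(`simulates_gate`). Blocks of `q` and `r` bits trade places by `q r` adjacent transpositions
(`realizes_blockSwap`), so a slice on `w` wires costs `O(w)` letters. Every slice adds at most one
bit to the state, so a circuit with `t` slices turns `0 x` into `0 f(x) h` within `1 + m + t` bit
positions (`simulates_slices`). The output is then copied behind the garbage by forks
(`realizes_copy`), the inverse of the first phase turns `0 f(x) h f(x)` into `0 x f(x)`, and a block
exchange yields `0 f(x) x` (`Circuit.realizes`). In all, `O(|C|²)` letters suffice, and no position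
beyond `1 + |C|` is used, for every circuit `C` that computes `f`.
-/

namespace Thompson

/-! ### Action of the group on words -/

theorem ThompsonGroup.mul_apply {g h : ThompsonGroup} {u v w : Word}
    (hu : h.1 u = some v) (hv : g.1 v = some w) : (g * h).1 u = some w :=
  le_iff.1 (ThompsonGroup.trans_le_mul g h) u w ((PEquiv.mem_trans _ _ _ _).2 ⟨v, hu, hv⟩)

theorem ThompsonGroup.inv_apply {g : ThompsonGroup} {u v : Word}
    (hu : g.1 u = some v) : g⁻¹.1 v = some u :=
  (PEquiv.mem_iff_mem g.1).2 hu

theorem tau_inv (i j : ℕ) (hi : 1 ≤ i) (hij : i < j) : (tau i j hi hij)⁻¹ = tau i j hi hij :=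
  ThompsonGroup.eq_ofIso _ _ _ (symm_le_symm (φ := bitTranspositionPEquiv i j)
    (le_maxExt (isRightIdealIso_bitTransposition hi hij)))

theorem swapBits_append_cons (A B C : Word) (a b : Bool) :
    swapBits (A.length + 1) (A.length + B.length + 2) (A ++ a :: (B ++ b :: C)) =
      A ++ b :: (B ++ a :: C) := by
  apply List.ext_getElem
  · simp [length_swapBits]
  · intro k h1 h2
    have h3 : k < (A ++ a :: (B ++ b :: C)).length := by rwa [length_swapBits] at h1
    rw [← List.getD_eq_getElem _ false h1, ← List.getD_eq_getElem _ false h2, getD_swapBits h3,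
      Equiv.swap_apply_def]
    simp only [List.getD_eq_getElem?_getD]
    split_ifs with h4 h5 <;> grind

/-- Where `τ_{i,j}` is defined, it exchanges two bits `a` and `b` of a word `A a B b C`. -/
theorem bitTransposition_eq_some {i j : ℕ} {w w' : Word} :
    bitTransposition i j w = some w' → ∃ A B C a b, i = A.length + 1 ∧ j = A.length + B.length + 2 ∧
      w = A ++ a :: (B ++ b :: C) ∧ w' = A ++ b :: (B ++ a :: C) := by
  intro h
  unfold bitTransposition at h
  split_ifs at h with hc
  obtain ⟨h1, h2, h3⟩ := hc
  have e : w = w.take (i - 1) ++ w[i - 1] :: ((w.drop i).take (j - i - 1) ++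
      w[j - 1] :: w.drop j) := by
    apply List.ext_getElem
    · simp; omega
    · intro k _ _
      grind
  have hA : (w.take (i - 1)).length = i - 1 := by simp; omega
  have hB : ((w.drop i).take (j - i - 1)).length = j - i - 1 := by simp; omega
  refine ⟨_, _, _, _, _, ?_, ?_, e, ?_⟩
  · omega
  · omega
  · rw [← swapBits_append_cons, ← e, hA, hB, Nat.sub_add_cancel h1]
    rw [show i - 1 + (j - i - 1) + 2 = j by omega]
    simpa using h.symm

theorem tau_apply (A C : Word) (a b : Bool) :
    (tau (A.length + 1) (A.length + 1 + 1) (Nat.le_add_left _ _) (Nat.lt_succ_self _)).1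
      (A ++ a :: b :: C) = some (A ++ b :: a :: C) := by
  refine le_iff.1 (le_maxExt (isRightIdealIso_bitTransposition (Nat.le_add_left _ _)
    (Nat.lt_succ_self _))) _ _ ?_
  change bitTransposition _ _ _ = _
  rw [bitTransposition, if_pos ⟨by omega, by omega, by simp⟩]
  exact congrArg some (swapBits_append_cons A [] C a b)

/-! ### Elements given by tables of prefix replacements -/

/-- The rows of `T` define a bijection between two finite maximal prefix codes whose words
have length at most `N`: no word is a prefix of another, and every word of length `N` has a
prefix in the code. -/
structure IsTable (N : ℕ) (T : List (Word × Word)) : Prop where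
  fst_prefix : ∀ p ∈ T, ∀ q ∈ T, p.1 <+: q.1 → p = q
  snd_prefix : ∀ p ∈ T, ∀ q ∈ T, p.2 <+: q.2 → p = q
  fst_complete : ∀ w : List.Vector Bool N, ∃ p ∈ T, p.1 <+: w.1
  snd_complete : ∀ w : List.Vector Bool N, ∃ p ∈ T, p.2 <+: w.1

/-- A table of prefix replacements `a ↦ b` extends to an element of `G_{2,1}` with
`a z ↦ b z` for every word `z`. -/
theorem IsTable.exists_element {N : ℕ} {T : List (Word × Word)} (hT : IsTable N T) :
    ∃ g : ThompsonGroup, ∀ p ∈ T, ∀ z : Word, g.1 (p.1 ++ z) = some (p.2 ++ z) := by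
  classical
  let R : Word → Word → Prop := fun u v => ∃ p ∈ T, ∃ z, u = p.1 ++ z ∧ v = p.2 ++ z
  have hR : ∀ {u v v'}, R u v → R u v' → v = v' := by
    rintro u v v' ⟨p, hp, z, rfl, rfl⟩ ⟨q, hq, z', h, rfl⟩
    have : p = q := by
      rcases List.prefix_or_prefix_of_prefix (List.prefix_append p.1 z) ⟨z', h.symm⟩ with h1 | h1
      · exact hT.fst_prefix _ hp _ hq h1
      · exact (hT.fst_prefix _ hq _ hp h1).symm
    subst this
    rw [List.append_cancel_left h]
  have hR' : ∀ {u u' v}, R u v → R u' v → u = u' := by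
    rintro u u' v ⟨p, hp, z, rfl, rfl⟩ ⟨q, hq, z', rfl, h⟩
    have : p = q := by
      rcases List.prefix_or_prefix_of_prefix (List.prefix_append p.2 z) ⟨z', h.symm⟩ with h1 | h1
      · exact hT.snd_prefix _ hp _ hq h1
      · exact (hT.snd_prefix _ hq _ hp h1).symm
    subst this
    rw [List.append_cancel_left h]
  have key : ∀ u v, (v ∈ if h : ∃ v, R u v then some h.choose else none) ↔ R u v := by
    intro u v
    split_ifs with h
    · rw [Option.mem_some_iff]
      exact ⟨fun e => e ▸ h.choose_spec, fun h' => hR h.choose_spec h'⟩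
    · simpa using fun h' => h ⟨v, h'⟩
  have key' : ∀ u v, (u ∈ if h : ∃ u, R u v then some h.choose else none) ↔ R u v := by
    intro u v
    split_ifs with h
    · rw [Option.mem_some_iff]
      exact ⟨fun e => e ▸ h.choose_spec, fun h' => hR' h.choose_spec h'⟩
    · simpa using fun h' => h ⟨u, h'⟩
  let φ : Word ≃. Word :=
    { toFun := fun u => if h : ∃ v, R u v then some h.choose else none
      invFun := fun v => if h : ∃ u, R u v then some h.choose else none
      inv := fun u v => (key' u v).trans (key u v).symm }
  have hφ : IsRightIdealIso φ := by
    refine isRightIdealIso_of (N := N) (M := N) ?_ ?_ ?_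
    · intro u v hv z
      obtain ⟨p, hp, y, rfl, rfl⟩ := (key u v).1 hv
      exact (key _ _).2 ⟨p, hp, y ++ z, by simp, by simp⟩
    · intro w hw
      obtain ⟨p, hp, h⟩ := hT.fst_complete ⟨w.take N, by simpa using hw⟩
      obtain ⟨z, rfl⟩ := h.trans (List.take_prefix N w)
      exact ⟨p.2 ++ z, (key _ _).2 ⟨p, hp, z, rfl, rfl⟩⟩
    · intro w hw
      obtain ⟨p, hp, h⟩ := hT.snd_complete ⟨w.take N, by simpa using hw⟩
      obtain ⟨z, rfl⟩ := h.trans (List.take_prefix N w)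
      exact ⟨p.1 ++ z, (key' _ _).2 ⟨p, hp, z, rfl, rfl⟩⟩
  exact ⟨ThompsonGroup.ofIso φ hφ, fun p hp z =>
    le_iff.1 (le_maxExt hφ) _ _ ((key _ _).2 ⟨p, hp, z, rfl, rfl⟩)⟩

/-! ### Gates -/

/-- The number of input wires of a gate. -/
def Gate.arity : Gate → ℕ
  | .and | .or => 2
  | .not | .fork => 1

/-- The bits on the output wires of a gate, given the bits on its input wires. -/
def Gate.output : Gate → Word → Word
  | .and, u => [u.all id]
  | .or, u => [u.any id]
  | .not, u => u.map (!·)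
  | .fork, u => u ++ u

/-- The bits that make a gate injective when they are kept next to its output. -/
def Gate.garbage : Gate → Word → Word
  | .fork, _ => []
  | _, u => u

/-- A bijection between maximal prefix codes that sends `0 u` to `0 g(u)` followed by the garbage
of `g`; the words that begin with `1` are used to fill up the image. -/
def Gate.table : Gate → List (Word × Word)
  | .and => [
    ([false, false, false], [false, false, false, false]),
    ([false, false, true], [false, false, false, true]),
    ([false, true, false], [false, false, true, false]),
    ([false, true, true], [false, true, true, true]),
    ([true, false], [true]),
    ([true, true, false], [false, true, false]),
    ([true, true, true, false], [false, false, true, true]),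
    ([true, true, true, true], [false, true, true, false])]
  | .or => [
    ([false, false, false], [false, false, false, false]),
    ([false, false, true], [false, true, false, true]),
    ([false, true, false], [false, true, true, false]),
    ([false, true, true], [false, true, true, true]),
    ([true, false], [true]),
    ([true, true, false], [false, false, true]),
    ([true, true, true, false], [false, false, false, true]),
    ([true, true, true, true], [false, true, false, false])]
  | .not => [
    ([false, false], [false, true, false]),
    ([false, true], [false, false, true]),
    ([true, false], [true]),
    ([true, true, false], [false, false, false]),
    ([true, true, true], [false, true, true])]
  | .fork => [
    ([false, false], [false, false, false]),
    ([false, true], [false, true, true]),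
    ([true, false], [true]),
    ([true, true, false], [false, false, true]),
    ([true, true, true], [false, true, false])]

theorem Gate.isTable_table (g : Gate) : IsTable 4 g.table := by
  cases g <;> exact ⟨by decide, by decide, by decide, by decide⟩

theorem Gate.mem_table (g : Gate) {u : Word} (hu : u.length = g.arity) :
    (false :: u, false :: (g.output u ++ g.garbage u)) ∈ g.table := by
  cases g
  · obtain ⟨a, b, rfl⟩ := List.length_eq_two.1 hu
    revert a b; decide
  · obtain ⟨a, b, rfl⟩ := List.length_eq_two.1 hu
    revert a b; decide
  · obtain ⟨a, rfl⟩ := List.length_eq_one_iff.1 hu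
    revert a; decide
  · obtain ⟨a, rfl⟩ := List.length_eq_one_iff.1 hu
    revert a; decide

/-- Every gate followed by its garbage is realized, below a leading `0`, by an element of
`G_{2,1}`. -/
theorem Gate.exists_element (g : Gate) : ∃ φ : ThompsonGroup, ∀ u z : Word,
    u.length = g.arity →
      φ.1 (false :: (u ++ z)) = some (false :: (g.output u ++ g.garbage u ++ z)) := by
  obtain ⟨φ, hφ⟩ := g.isTable_table.exists_element
  exact ⟨φ, fun u z hu => hφ _ (g.mem_table hu) z⟩

/-- The number of output wires of a gate. -/
def Gate.coarity : Gate → ℕ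
  | .fork => 2
  | _ => 1

/-- The number of garbage bits of a gate. -/
def Gate.garbageLength : Gate → ℕ
  | .and | .or => 2
  | .not => 1
  | .fork => 0

theorem Gate.length_output (g : Gate) {u : Word} (hu : u.length = g.arity) :
    (g.output u).length = g.coarity := by
  cases g <;> simp_all [Gate.output, Gate.coarity, Gate.arity]

theorem Gate.length_garbage (g : Gate) {u : Word} (hu : u.length = g.arity) :
    (g.garbage u).length = g.garbageLength := by
  cases g <;> simp_all [Gate.garbage, Gate.garbageLength, Gate.arity]

theorem Gate.apply_eq_some {g : Gate} {w w' : Word} (h : g.apply w = some w') :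
    ∃ u z, u.length = g.arity ∧ w = u ++ z ∧ w' = g.output u ++ z := by
  cases g
  · match w, h with
    | a :: b :: z, h => exact ⟨[a, b], z, rfl, rfl, by simpa [Gate.output, Gate.apply] using h.symm⟩
  · match w, h with
    | a :: b :: z, h => exact ⟨[a, b], z, rfl, rfl, by simpa [Gate.output, Gate.apply] using h.symm⟩
  · match w, h with
    | a :: z, h => exact ⟨[a], z, rfl, rfl, by simpa [Gate.output, Gate.apply] using h.symm⟩
  · match w, h with
    | a :: z, h => exact ⟨[a], z, rfl, rfl, by simpa [Gate.output, Gate.apply] using h.symm⟩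

theorem belowWires_eq_some {F : Word → Option Word} {k : ℕ} {w w' : Word}
    (h : belowWires F k w = some w') :
    ∃ A u u', A.length = k ∧ F u = some u' ∧ w = A ++ u ∧ w' = A ++ u' := by
  induction k generalizing w w' with
  | zero => exact ⟨[], w, w', rfl, h, rfl, rfl⟩
  | succ k ih =>
    match w, h with
    | x :: w, h =>
      obtain ⟨v, hv, rfl⟩ := Option.map_eq_some_iff.1 h
      obtain ⟨A, u, u', rfl, h1, rfl, rfl⟩ := ih hv
      exact ⟨x :: A, u, u', rfl, h1, rfl, rfl⟩

/-! ### Word realizations of relations -/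

variable {Γ : Set ThompsonGroup}

/-- Some word of length at most `ℓ`, all of whose symbols `τ_{i,i+1}` satisfy `i + 1 ≤ N`,
represents an element of `G_{2,1}` that maps `u` to `v` whenever `R u v`. -/
def Realizes (Γ : Set ThompsonGroup) (ℓ N : ℕ) (R : Word → Word → Prop) : Prop :=
  ∃ W : List (Letter Γ), W.length ≤ ℓ ∧
    (∀ (i : ℕ) (hi : 1 ≤ i), Letter.trans i hi ∈ W → i + 1 ≤ N) ∧
    ∀ u v, R u v → (evalWord W).1 u = some v

theorem evalWord_append (W W' : List (Letter Γ)) :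
    evalWord (W ++ W') = evalWord W * evalWord W' := by
  simp [evalWord]

theorem evalWord_cons (a : Letter Γ) (W : List (Letter Γ)) :
    evalWord (a :: W) = a.eval * evalWord W := by
  simp [evalWord]

/-- The formal inverse of a letter; the symbols `τ_{i,i+1}` are their own inverses. -/
def Letter.inv : Letter Γ → Letter Γ
  | .gen g => .genInv g
  | .genInv g => .gen g
  | .trans i hi => .trans i hi

theorem Letter.eval_inv (a : Letter Γ) : a.inv.eval = a.eval⁻¹ := by
  cases a with
  | gen g => rfl
  | genInv g => exact (inv_inv _).symm
  | trans i hi => exact (tau_inv i (i + 1) hi (Nat.lt_succ_self i)).symm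

theorem evalWord_reverse_inv (W : List (Letter Γ)) :
    evalWord (W.map Letter.inv).reverse = (evalWord W)⁻¹ := by
  induction W with
  | nil => simp [evalWord]
  | cons a W ih =>
    rw [List.map_cons, List.reverse_cons, evalWord_append, ih, evalWord_cons, evalWord_cons,
      mul_inv_rev, Letter.eval_inv]
    simp [evalWord]

theorem Realizes.mono {ℓ ℓ' N N' : ℕ} {R S : Word → Word → Prop} (h : Realizes Γ ℓ N R)
    (hℓ : ℓ ≤ ℓ') (hN : N ≤ N') (hS : ∀ u v, S u v → R u v) : Realizes Γ ℓ' N' S := by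
  obtain ⟨W, h1, h2, h3⟩ := h
  exact ⟨W, h1.trans hℓ, fun i hi hm => (h2 i hi hm).trans hN, fun u v huv => h3 u v (hS u v huv)⟩

theorem Realizes.comp {ℓ ℓ' N : ℕ} {R S : Word → Word → Prop} (h : Realizes Γ ℓ N R)
    (h' : Realizes Γ ℓ' N S) : Realizes Γ (ℓ + ℓ') N (Relation.Comp R S) := by
  obtain ⟨W, h1, h2, h3⟩ := h
  obtain ⟨W', h1', h2', h3'⟩ := h'
  refine ⟨W' ++ W, by simp; omega, fun i hi hm => ?_, ?_⟩
  · rcases List.mem_append.1 hm with hm | hm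
    · exact h2' i hi hm
    · exact h2 i hi hm
  · rintro u w ⟨v, huv, hvw⟩
    rw [evalWord_append]
    exact ThompsonGroup.mul_apply (h3 _ _ huv) (h3' _ _ hvw)

theorem Realizes.flip {ℓ N : ℕ} {R : Word → Word → Prop} (h : Realizes Γ ℓ N R) :
    Realizes Γ ℓ N (flip R) := by
  obtain ⟨W, h1, h2, h3⟩ := h
  refine ⟨(W.map Letter.inv).reverse, by simpa using h1, fun i hi hm => ?_, fun u v huv => ?_⟩
  · rw [List.mem_reverse, List.mem_map] at hm
    obtain ⟨a, ha, e⟩ := hm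
    cases a with
    | gen g => cases e
    | genInv g => cases e
    | trans k hk => cases e; exact h2 _ _ ha
  · rw [evalWord_reverse_inv]
    exact ThompsonGroup.inv_apply (h3 _ _ huv)

theorem Realizes.refl (ℓ N : ℕ) {R : Word → Word → Prop} (hR : ∀ u v, R u v → u = v) :
    Realizes Γ ℓ N R :=
  ⟨[], by simp, by simp, fun u v huv => by
    cases hR u v huv
    change (PEquiv.refl Word) u = some u
    simp⟩

theorem exists_word (hgen : Subgroup.closure Γ = ⊤) (g : ThompsonGroup) :
    ∃ W : List (Letter Γ), (∀ (i : ℕ) (hi : 1 ≤ i), Letter.trans i hi ∉ W) ∧ evalWord W = g := by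
  have hg : g ∈ Subgroup.closure Γ := hgen ▸ Subgroup.mem_top g
  induction hg using Subgroup.closure_induction with
  | mem x hx => exact ⟨[.gen ⟨x, hx⟩], by simp, by simp [evalWord, Letter.eval]⟩
  | one => exact ⟨[], by simp, rfl⟩
  | mul x y _ _ hx hy =>
    obtain ⟨V, h1, rfl⟩ := hx
    obtain ⟨W, h2, rfl⟩ := hy
    exact ⟨V ++ W, fun i hi => by simp [h1, h2], evalWord_append V W⟩
  | inv x _ hx =>
    obtain ⟨V, h1, rfl⟩ := hx
    refine ⟨(V.map Letter.inv).reverse, fun i hi hm => ?_, evalWord_reverse_inv V⟩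
    rw [List.mem_reverse, List.mem_map] at hm
    obtain ⟨a, ha, e⟩ := hm
    cases a with
    | gen g => cases e
    | genInv g => cases e
    | trans k hk => cases e; exact h1 _ _ ha

/-- The action of a gate, with its garbage, on the bits that follow a leading `0`. -/
def Gate.Rel (g : Gate) (u v : Word) : Prop :=
  ∃ x z : Word, x.length = g.arity ∧ u = false :: (x ++ z) ∧
    v = false :: (g.output x ++ g.garbage x ++ z)

/-- The gates are finitely many fixed elements of `G_{2,1}`, so over a generating set they cost a
constant number of letters and no symbol `τ_{i,i+1}`. -/
theorem exists_gate_bound (hgen : Subgroup.closure Γ = ⊤) :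
    ∃ K : ℕ, ∀ g : Gate, Realizes Γ K 0 g.Rel := by
  have h : ∀ g : Gate, ∃ K, Realizes Γ K 0 g.Rel := by
    intro g
    obtain ⟨φ, hφ⟩ := g.exists_element
    obtain ⟨W, h1, rfl⟩ := exists_word hgen φ
    exact ⟨W.length, W, le_rfl, fun i hi hm => absurd hm (h1 i hi), by
      rintro _ _ ⟨x, z, hx, rfl, rfl⟩; exact hφ x z hx⟩
  choose K hK using h
  refine ⟨K .and + K .or + K .not + K .fork, fun g => (hK g).mono ?_ le_rfl fun _ _ => id⟩
  cases g <;> omega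

/-! ### Permuting blocks of bits by adjacent transpositions -/

/-- Two neighbouring blocks, of lengths `q` and `r`, that follow the first `p` bits trade places. -/
def BlockSwap (p q r : ℕ) (u v : Word) : Prop :=
  ∃ A X B C : Word, A.length = p ∧ X.length = q ∧ B.length = r ∧
    u = A ++ X ++ B ++ C ∧ v = A ++ B ++ X ++ C

theorem realizes_bitSwap (p : ℕ) : Realizes Γ 1 (p + 2) (BlockSwap p 1 1) := by
  refine ⟨[.trans (p + 1) (Nat.le_add_left _ _)], le_rfl, ?_, ?_⟩
  · intro i hi hm
    rw [List.mem_singleton] at hm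
    cases hm
    rfl
  · rintro _ _ ⟨A, X, B, C, rfl, hX, hB, rfl, rfl⟩
    obtain ⟨a, rfl⟩ := List.length_eq_one_iff.1 hX
    obtain ⟨b, rfl⟩ := List.length_eq_one_iff.1 hB
    simpa [evalWord, Letter.eval] using tau_apply A C a b

theorem realizes_bit_blockSwap (p r : ℕ) : Realizes Γ r (p + 1 + r) (BlockSwap p 1 r) := by
  induction r generalizing p with
  | zero =>
    refine Realizes.refl _ _ ?_
    rintro _ _ ⟨A, X, B, C, -, -, hB, rfl, rfl⟩
    simp [List.length_eq_zero_iff.1 hB]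
  | succ r ih =>
    refine (((realizes_bitSwap p).mono (N' := p + 1 + (r + 1)) le_rfl (by omega) fun _ _ => id).comp
      ((ih (p + 1)).mono le_rfl (by omega) fun _ _ => id)).mono (by omega) le_rfl ?_
    rintro _ _ ⟨A, X, B, C, hA, hX, hB, rfl, rfl⟩
    match B, hB with
    | b :: B, hB =>
      exact ⟨A ++ [b] ++ X ++ (B ++ C), ⟨A, X, [b], B ++ C, hA, hX, rfl, by simp, by simp⟩,
        A ++ [b], X, B, C, by simp [hA], hX, by simpa using hB, by simp, by simp⟩

theorem realizes_blockSwap (p q r : ℕ) : Realizes Γ (q * r) (p + q + r) (BlockSwap p q r) := by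
  induction q generalizing p with
  | zero =>
    refine Realizes.refl _ _ ?_
    rintro _ _ ⟨A, X, B, C, -, hX, -, rfl, rfl⟩
    simp [List.length_eq_zero_iff.1 hX]
  | succ q ih =>
    refine (((ih (p + 1)).mono (N' := p + (q + 1) + r) le_rfl (by omega) fun _ _ => id).comp
      ((realizes_bit_blockSwap p r).mono le_rfl (by omega) fun _ _ => id)).mono
        (by rw [Nat.succ_mul]) le_rfl ?_
    rintro _ _ ⟨A, X, B, C, hA, hX, hB, rfl, rfl⟩
    match X, hX with
    | x :: X, hX =>
      exact ⟨A ++ [x] ++ B ++ X ++ C, ⟨A ++ [x], X, B, C, by simp [hA], by simpa using hX, hB,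
        by simp, by simp⟩, A, [x], B, X ++ C, hA, rfl, hB, by simp, by simp⟩

/-! ### Reversible simulation of circuits -/

/-- Simulation of a partial map `F` on the words of length `m`, below a leading `0`; the bits
`G x` are left behind the value `F x`. -/
def SimRel (m : ℕ) (F : Word → Option Word) (G : Word → Word) (u v : Word) : Prop :=
  ∃ x y z : Word, x.length = m ∧ F x = some y ∧ u = false :: (x ++ z) ∧
    v = false :: (y ++ G x ++ z)

/-- `F` is simulated on the words of length `m` by a word of length at most `ℓ`, in such a way
that at most `d` bits are added; `1 + m + d` bounds the positions that are touched, since no more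
bits than that are ever in use. The numbers of output bits and of bits left behind are the same
for all arguments where `F` is defined, so one word serves them all. -/
def Simulates (Γ : Set ThompsonGroup) (ℓ m d : ℕ) (F : Word → Option Word) : Prop :=
  ∃ (n l : ℕ) (G : Word → Word), n + l ≤ m + d ∧
    (∀ x y : Word, x.length = m → F x = some y → y.length = n ∧ (G x).length = l) ∧
    Realizes Γ ℓ (1 + m + d) (SimRel m F G)

theorem Gate.coarity_add_garbageLength (g : Gate) : g.coarity + g.garbageLength = g.arity + 1 := by
  cases g <;> rfl

theorem Gate.arity_le_two (g : Gate) : g.arity ≤ 2 := by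
  cases g <;> decide

theorem Gate.garbageLength_le_two (g : Gate) : g.garbageLength ≤ 2 := by
  cases g <;> decide

/-- The input bits of the gate are moved to the front, the gate is applied, its output is moved
back to where the inputs were, and its garbage is moved behind all the wires. -/
theorem simulates_gate {K : ℕ} (hK : ∀ g : Gate, Realizes Γ K 0 g.Rel) (g : Gate) (k m : ℕ) :
    Simulates Γ (7 * m + K) m 1 (belowWires g.apply k) := by
  have hsplit : ∀ {x y : Word}, belowWires g.apply k x = some y →
      ∃ A u B, A.length = k ∧ u.length = g.arity ∧ x = A ++ u ++ B ∧ y = A ++ g.output u ++ B := by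
    intro x y h
    obtain ⟨A, w, w', hA, hw, rfl, rfl⟩ := belowWires_eq_some h
    obtain ⟨u, z, hu, rfl, rfl⟩ := Gate.apply_eq_some hw
    exact ⟨A, u, z, hA, hu, by simp, by simp⟩
  by_cases hm : k + g.arity ≤ m
  · obtain ⟨r, rfl⟩ := Nat.exists_eq_add_of_le hm
    have e := g.coarity_add_garbageLength
    have e2 := g.arity_le_two
    have e3 := g.garbageLength_le_two
    have hmid : ∀ (A u B : Word), A.length = k → u.length = g.arity →
        (((A ++ u ++ B).drop k).take g.arity) = u := by
      rintro A u B rfl h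
      rw [← h]; simp
    refine ⟨k + g.coarity + r, g.garbageLength, fun x => g.garbage ((x.drop k).take g.arity),
      by omega, ?_, ?_⟩
    · intro x y hx h
      obtain ⟨A, u, B, hA, hu, rfl, rfl⟩ := hsplit h
      simp only [List.length_append] at hx
      refine ⟨?_, ?_⟩
      · simp [g.length_output hu]; omega
      · exact (congrArg (fun w => (g.garbage w).length) (hmid A u B hA hu)).trans
          (g.length_garbage hu)
    · have s1 := (realizes_blockSwap (Γ := Γ) 1 k g.arity).mono
        (N' := 1 + (k + g.arity + r) + 1) le_rfl (by omega) fun _ _ => id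
      have s2 := (hK g).mono (N' := 1 + (k + g.arity + r) + 1) le_rfl (by omega) fun _ _ => id
      have s3 := (realizes_blockSwap (Γ := Γ) 1 (g.coarity + g.garbageLength) k).mono
        (N' := 1 + (k + g.arity + r) + 1) le_rfl (by omega) fun _ _ => id
      have s4 := (realizes_blockSwap (Γ := Γ) (1 + k + g.coarity) g.garbageLength r).mono
        (N' := 1 + (k + g.arity + r) + 1) le_rfl (by omega) fun _ _ => id
      refine (((s1.comp s2).comp s3).comp s4).mono ?_ le_rfl ?_
      · have b1 : k * g.arity ≤ k * 2 := Nat.mul_le_mul_left _ e2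
        have b2 : (g.coarity + g.garbageLength) * k ≤ 3 * k := Nat.mul_le_mul_right _ (by omega)
        have b3 : g.garbageLength * r ≤ 2 * r := Nat.mul_le_mul_right _ e3
        omega
      · rintro _ _ ⟨x, y, z, hx, h, rfl, rfl⟩
        obtain ⟨A, u, B, hA, hu, rfl, rfl⟩ := hsplit h
        simp only [List.length_append] at hx
        beta_reduce
        rw [hmid A u B hA hu]
        refine ⟨_, ⟨_, ⟨_, ⟨[false], A, u, B ++ z, rfl, hA, hu, by simp, rfl⟩,
          u, A ++ B ++ z, hu, by simp, rfl⟩, [false], g.output u ++ g.garbage u, A, B ++ z,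
          rfl, by simp [g.length_output hu, g.length_garbage hu], hA, by simp, rfl⟩,
          false :: (A ++ g.output u), g.garbage u, B, z,
          by simp [g.length_output hu, hA]; omega, g.length_garbage hu, by omega,
          by simp, by simp⟩
  -- With too few wires the gate is undefined, and there is nothing to realize.
  · have hnone : ∀ x y : Word, x.length = m → belowWires g.apply k x = some y → False := by
      intro x y hx h
      obtain ⟨A, u, B, hA, hu, rfl, rfl⟩ := hsplit h
      simp only [List.length_append] at hx
      omega
    refine ⟨0, 0, id, by omega, fun x y hx h => (hnone x y hx h).elim, Realizes.refl _ _ ?_⟩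
    rintro _ _ ⟨x, y, z, hx, h, -, -⟩
    exact (hnone x y hx h).elim

/-- In `A a B b C` the bit `a` is moved behind `B b`, and then `b` is moved in front of `B`. -/
theorem simulates_bitTransposition (i j m : ℕ) :
    Simulates Γ (2 * m) m 1 (bitTransposition i j) := by
  refine ⟨m, 0, fun _ => [], by omega, ?_, ?_⟩
  · intro x y hx h
    obtain ⟨A, B, C, a, b, -, -, rfl, rfl⟩ := bitTransposition_eq_some h
    simpa using hx
  · by_cases hj : i < j ∧ j ≤ m
    · have s1 := (realizes_blockSwap (Γ := Γ) i 1 (j - i)).mono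
        (N' := 1 + m + 1) le_rfl (by omega) fun _ _ => id
      have s2 := (realizes_blockSwap (Γ := Γ) i (j - i - 1) 1).mono
        (N' := 1 + m + 1) le_rfl (by omega) fun _ _ => id
      refine (s1.comp s2).mono (by omega) le_rfl ?_
      rintro _ _ ⟨x, y, z, hx, h, rfl, rfl⟩
      obtain ⟨A, B, C, a, b, rfl, rfl, rfl, rfl⟩ := bitTransposition_eq_some h
      exact ⟨_, ⟨false :: A, [a], B ++ [b], C ++ z, by simp, rfl, by simp; omega, by simp, rfl⟩,
        false :: A, B, [b], a :: (C ++ z), by simp, by omega, rfl, by simp, by simp⟩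
    · refine Realizes.refl _ _ ?_
      rintro _ _ ⟨x, y, z, hx, h, rfl, rfl⟩
      obtain ⟨A, B, C, a, b, rfl, rfl, rfl, rfl⟩ := bitTransposition_eq_some h
      simp at hx
      omega

theorem simulates_slice {K : ℕ} (hK : ∀ g : Gate, Realizes Γ K 0 g.Rel) (s : Slice) (m : ℕ) :
    Simulates Γ (7 * m + K) m 1 s.apply := by
  cases s with
  | gate g k => exact simulates_gate hK g k m
  | swap i j =>
    obtain ⟨n, l, G, h1, h2, h3⟩ := simulates_bitTransposition (Γ := Γ) i j m
    exact ⟨n, l, G, h1, h2, h3.mono (by omega) le_rfl fun _ _ => id⟩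

/-- The garbage of each slice is stored in front of the garbage of the earlier slices. -/
theorem simulates_slices {K : ℕ} (hK : ∀ g : Gate, Realizes Γ K 0 g.Rel) (S : List Slice)
    (m : ℕ) : Simulates Γ (S.length * (7 * (m + S.length) + K)) m S.length
      (fun x => S.foldlM (fun w s => s.apply w) x) := by
  induction S generalizing m with
  | nil =>
    refine ⟨m, 0, fun _ => [], by simp, ?_, Realizes.refl _ _ ?_⟩
    · intro x y hx h
      simp at h
      simp [← h, hx]
    · rintro _ _ ⟨x, y, z, hx, h, rfl, rfl⟩
      simp at h
      simp [h]
  | cons s S ih =>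
    obtain ⟨n₁, l₁, G₁, a1, a2, a3⟩ := simulates_slice hK s m
    obtain ⟨n₂, l₂, G₂, b1, b2, b3⟩ := ih n₁
    have hs : ∀ {x y : Word}, (s :: S).foldlM (fun w s => s.apply w) x = some y →
        ∃ w, s.apply x = some w ∧ S.foldlM (fun w s => s.apply w) w = some y := by
      intro x y h
      rw [List.foldlM_cons] at h
      exact Option.bind_eq_some_iff.1 h
    -- The default value `[]` occurs only where the first slice is undefined.
    refine ⟨n₂, l₂ + l₁, fun x => G₂ ((s.apply x).getD []) ++ G₁ x,
      by rw [List.length_cons]; omega, ?_, ?_⟩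
    · intro x y hx h
      obtain ⟨w, hw, hy⟩ := hs h
      obtain ⟨c1, c2⟩ := a2 x w hx hw
      obtain ⟨c3, c4⟩ := b2 w y c1 hy
      simp [hw, c2, c3, c4]
    · refine ((a3.mono (N' := 1 + m + (s :: S).length) le_rfl (by simp) fun _ _ => id).comp
        (b3.mono le_rfl (by simp; omega) fun _ _ => id)).mono ?_ le_rfl ?_
      · rw [List.length_cons, Nat.add_comm (7 * m + K), Nat.succ_mul S.length]
        refine Nat.add_le_add (Nat.mul_le_mul_left _ ?_) ?_ <;> omega
      · rintro _ _ ⟨x, y, z, hx, h, rfl, rfl⟩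
        obtain ⟨w, hw, hy⟩ := hs h
        exact ⟨_, ⟨x, w, z, hx, hw, rfl, rfl⟩, w, y, G₁ x ++ z, (a2 x w hx hw).1, hy,
          by simp, by simp [hw]⟩

/-! ### Copying a block of bits -/

/-- A block `y` of length `n`, which follows `p` bits after the leading `0`, is copied behind the
next `l` bits. -/
def CopyRel (p n l : ℕ) (u v : Word) : Prop :=
  ∃ A y H z : Word, A.length = p ∧ y.length = n ∧ H.length = l ∧
    u = false :: (A ++ y ++ H ++ z) ∧ v = false :: (A ++ y ++ H ++ y ++ z)

/-- The first bit of the block is moved to the front and doubled by a fork; both copies are put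
back, and one of them is moved on behind the rest of the block and the `l` bits. Then it counts
as part of these bits, and the remaining block is copied. -/
theorem realizes_copy {K : ℕ} (hK : ∀ g : Gate, Realizes Γ K 0 g.Rel) (p n l : ℕ) :
    Realizes Γ (n * (4 * (p + n + l + n) + K)) (1 + (p + n + l + n)) (CopyRel p n l) := by
  induction n generalizing p l with
  | zero =>
    refine Realizes.refl _ _ ?_
    rintro _ _ ⟨A, y, H, z, -, hy, -, rfl, rfl⟩
    simp [List.length_eq_zero_iff.1 hy]
  | succ n ih =>
    set N := 1 + (p + (n + 1) + l + (n + 1)) with hN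
    have s1 := (realizes_blockSwap (Γ := Γ) 1 p 1).mono (N' := N) le_rfl (by omega) fun _ _ => id
    have s2 := (hK .fork).mono (N' := N) le_rfl (by omega) fun _ _ => id
    have s3 := (realizes_blockSwap (Γ := Γ) 1 2 p).mono (N' := N) le_rfl (by omega) fun _ _ => id
    have s4 := (realizes_blockSwap (Γ := Γ) (1 + p + 1) 1 (n + l)).mono (N' := N) le_rfl
      (by omega) fun _ _ => id
    have s5 := (ih (p + 1) (l + 1)).mono (N' := N) le_rfl (by omega) fun _ _ => id
    refine ((((s1.comp s2).comp s3).comp s4).comp s5).mono ?_ le_rfl ?_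
    · rw [show p + 1 + n + (l + 1) + n = p + (n + 1) + l + (n + 1) by omega, Nat.succ_mul n]
      omega
    · rintro _ _ ⟨A, y, H, z, hA, hy, hH, rfl, rfl⟩
      match y, hy with
      | a :: y, hy =>
        have hy' : y.length = n := by simpa using hy
        exact ⟨_, ⟨_, ⟨_, ⟨_, ⟨[false], A, [a], y ++ H ++ z, rfl, hA, rfl, by simp, rfl⟩,
          [a], A ++ y ++ H ++ z, rfl, by simp, rfl⟩,
          [false], [a, a], A, y ++ H ++ z, rfl, rfl, hA, by simp [Gate.output, Gate.garbage], rfl⟩,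
          false :: (A ++ [a]), [a], y ++ H, z, by simp [hA]; omega, rfl, by simp [hy', hH],
          by simp, rfl⟩, A ++ [a], y, H ++ [a], z, by simp [hA], hy', by simp [hH],
          by simp, by simp⟩

/-! ### Computing, copying the output, and uncomputing -/

/-- `0 x` is mapped to `0 y h`, then to `0 y h y`, then by the inverse of the first step to
`0 x y`, and finally to `0 y x`. -/
theorem Circuit.realizes {K : ℕ} (hK : ∀ g : Gate, Realizes Γ K 0 g.Rel) {m n : ℕ}
    (C : Circuit m n) :
    Realizes Γ ((19 + 3 * K) * C.size ^ 2) (1 + C.size) (fun u v => ∃ x y : Word, x.length = m ∧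
      y.length = n ∧ C.run x = some y ∧ u = false :: x ∧ v = false :: (y ++ x)) := by
  obtain ⟨n', l, G, h1, h2, h3⟩ := simulates_slices hK C.slices m
  have hs : C.size = m + n + C.slices.length := rfl
  set s := C.size
  set t := C.slices.length
  by_cases hn : n' = n
  · subst hn
    have s1 := h3.mono (N' := 1 + s) le_rfl (by omega) fun _ _ => id
    have s2 := (realizes_copy hK 0 n' l).mono (N' := 1 + s) le_rfl (by omega) fun _ _ => id
    have s4 := (realizes_blockSwap (Γ := Γ) 1 m n').mono (N' := 1 + s) le_rfl (by omega)
      fun _ _ => id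
    refine (((s1.comp s2).comp s1.flip).comp s4).mono ?_ le_rfl ?_
    · have b0 : ∀ a r b : ℕ, a ≤ s → b ≤ s → a * (r * b + K) ≤ (r + K) * s ^ 2 := by
        intro a r b ha hb
        calc a * (r * b + K) ≤ s * (r * s + K) := by gcongr
          _ ≤ (r + K) * s ^ 2 := by nlinarith [Nat.le_self_pow two_ne_zero s]
      have b1 := b0 t 7 (m + t) (by omega) (by omega)
      have b2 := b0 n' 4 (0 + n' + l + n') (by omega) (by omega)
      have b3 : m * n' ≤ s ^ 2 := by
        rw [sq]; exact Nat.mul_le_mul (by omega) (by omega)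
      linarith
    · rintro _ _ ⟨x, y, hx, hy, h, rfl, rfl⟩
      exact ⟨_, ⟨_, ⟨_, ⟨x, y, [], hx, h, by simp, rfl⟩,
        [], y, G x, [], rfl, hy, (h2 x y hx h).2, by simp, rfl⟩,
        x, y, y, hx, h, rfl, by simp⟩, [false], x, y, [], rfl, hx, hy, by simp, by simp⟩
  -- If the circuit does not end with `n` wires, the relation is empty.
  · refine Realizes.refl _ _ ?_
    rintro _ _ ⟨x, y, hx, hy, h, -, -⟩
    exact absurd ((h2 x y hx h).1.symm.trans hy) hn

end Thompson

theorem mainTheorem3 (Γ : Set Thompson.ThompsonGroup) (hfin : Γ.Finite)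
    (hgen : Subgroup.closure Γ = ⊤) :
    ∃ c : ℕ, ∀ (m n : ℕ) (f : (Fin m → Bool) → (Fin n → Bool)) (C : Thompson.Circuit m n),
      C.IsMinimumFor f →
      ∃ W : List (Thompson.Letter Γ),
        (∀ x : Fin m → Bool,
          (Thompson.evalWord W).1 (false :: List.ofFn x) =
            some (false :: (List.ofFn (f x) ++ List.ofFn x))) ∧
        W.length ≤ c * C.size ^ 4 ∧
        ∀ (i : ℕ) (hi : 1 ≤ i), Thompson.Letter.trans i hi ∈ W → i + 1 ≤ C.size ^ 2 + 2 := by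
  obtain ⟨K, hK⟩ := Thompson.exists_gate_bound hgen
  refine ⟨19 + 3 * K, fun m n f C hC => ?_⟩
  obtain ⟨W, h1, h2, h3⟩ := Thompson.Circuit.realizes hK C
  have hs : C.size ≤ C.size ^ 2 := Nat.le_self_pow (by decide) _
  refine ⟨W, fun x => h3 _ _ ⟨_, _, by simp, by simp, hC.1 x, rfl, rfl⟩, ?_, fun i hi hm => ?_⟩
  · refine h1.trans (Nat.mul_le_mul_left _ ?_)
    rw [show C.size ^ 4 = (C.size ^ 2) ^ 2 by ring]
    exact Nat.le_self_pow (by decide) _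
  · have := h2 i hi hm
    omega
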